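/- Let $(X_n)_n$ be a countable (finite or countably infinite) family of Polish spaces and let $X=\prod_n X_n$ carry the product topology. Write $C_b$, $U_b$, $B_b$ for the sets of bounded functions $f:X\to\mathbb R$ that are continuous, upper semicontinuous, Borel measurable, respectively, and $B_{b,n}^+$ for the set of bounded Borel functions $X_n\to[0,\infty)$. For each $n$ let $\mathcal P_n$ be a nonempty convex set of Borel probability measures on $X_n$ that is compact in the topology of weak convergence (the topology induced by integration against bounded continuous functions), and put $\phi_n(g)=\sup_{\nu\in\mathcal P_n}\int g\,d\nu$ for $g\in B_{b,n}^+$. Let $\mathcal P$ be the set of Borel probability measures on $X$ whose $n$-th marginal belongs to $\mathcal P_n$ for every $n$. For $g_n\in B_{b,n}^+$ let $\oplus g:X\to[0,\infty]$, $(\oplus g)(x)=\sum_n g_n(x_n)$. Let $\phi:B_b\to\mathbb R$ be convex and increasing (that is, $\phi(f)\ge\phi(g)$ whenever $f\ge g$ pointwise), and suppose that $$\phi(f)\le m+\sum_n\phi_n(g_n)\quad\text{whenever } f\in B_b,\ m\in\mathbb R,\ g_n\in B_{b,n}^+ \text{ satisfy } f\le m+\oplus g \text{ pointwise},$$ where the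 right-hand side may be $+\infty$. For a finite Borel measure $\mu$ on $X$ set $\phi^*_{C_b}(\mu)=\sup_{f\in C_b}\left(\int f\,d\mu-\phi(f)\right)$ and $\phi^*_{U_b}(\mu)=\sup_{f\in U_b}\left(\int f\,d\mu-\phi(f)\right)$, with values in $\mathbb R\cup\{+\infty\}$. Then $$\phi(f)=\max_{\mu\in\mathcal P}\left(\int f\,d\mu-\phi^*_{C_b}(\mu)\right)\quad\text{for all } f\in C_b,$$ where the maximum is attained. If, in addition, $\phi^*_{C_b}(\mu)=\phi^*_{U_b}(\mu)$ for all $\mu\in\mathcal P$, then the same representation (with attained maximum) holds for all $f\in U_b$. -/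

import Mathlib

open MeasureTheory
open scoped ENNReal NNReal

noncomputable section

/-- `B_b(Y)`: the ordered vector space of bounded measurable functions `Y → ℝ`, with the pointwise
order. (For a Borel `σ`-algebra these are the bounded Borel functions.) -/
def BoundedBorel (Y : Type*) [MeasurableSpace Y] : Submodule ℝ (Y → ℝ) where
  carrier := {f | Measurable f ∧ ∃ C : ℝ, ∀ y, |f y| ≤ C}
  zero_mem' := ⟨measurable_zero, 0, fun _ => by simp⟩
  add_mem' := by
    rintro f g ⟨hf, C, hC⟩ ⟨hg, D, hD⟩
    exact ⟨hf.add hg, C + D, fun y => (abs_add_le _ _).trans (add_le_add (hC y) (hD y))⟩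
  smul_mem' := by
    rintro c f ⟨hf, C, hC⟩
    refine ⟨hf.const_smul c, |c| * C, fun y => ?_⟩
    simpa [abs_mul] using mul_le_mul_of_nonneg_left (hC y) (abs_nonneg c)

/-- `C_b(Y)`: the bounded continuous functions, as a subset of `B_b(Y)`. -/
def boundedContinuous (Y : Type*) [TopologicalSpace Y] [MeasurableSpace Y] :
    Set (BoundedBorel Y) :=
  {f | Continuous (f : Y → ℝ)}

/-- `U_b(Y)`: the bounded upper semicontinuous functions, as a subset of `B_b(Y)`. -/
def boundedUSC (Y : Type*) [TopologicalSpace Y] [MeasurableSpace Y] :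
    Set (BoundedBorel Y) :=
  {f | UpperSemicontinuous (f : Y → ℝ)}

/-- The convex conjugate `φ*_S(μ) = sup_{f ∈ S} (∫ f dμ - φ(f))` of `φ : B_b(Y) → ℝ` relative to a
set `S` of functions, at a finite measure `μ`; the supremum is taken in `[-∞, ∞]`. -/
def convexConjugate {Y : Type*} [MeasurableSpace Y] (φ : BoundedBorel Y → ℝ)
    (S : Set (BoundedBorel Y)) (μ : FiniteMeasure Y) : EReal :=
  ⨆ f ∈ S, ((∫ y, (f : Y → ℝ) y ∂(μ : Measure Y) - φ f : ℝ) : EReal)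

/-- The functional `g ↦ sup_{ν ∈ Q} ∫ g dν` given by a set `Q` of probability measures. For
nonempty `Q` the set of integrals is nonempty and bounded, so the real supremum is the usual one. -/
def upperExpectation {Y : Type*} [MeasurableSpace Y] (Q : Set (ProbabilityMeasure Y))
    (g : BoundedBorel Y) : ℝ :=
  sSup ((fun ν : ProbabilityMeasure Y => ∫ y, (g : Y → ℝ) y ∂(ν : Measure Y)) '' Q)

/-- `⊕ g : x ↦ ∑ₙ gₙ(xₙ)` with values in `[0, ∞]`, for nonnegative `gₙ`. -/
def directSumFn {ι : Type*} {X : ι → Type*} [∀ n, MeasurableSpace (X n)]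
    (g : ∀ n, BoundedBorel (X n)) (x : ∀ n, X n) : ℝ≥0∞ :=
  ∑' n, ENNReal.ofReal ((g n : X n → ℝ) (x n))

/-- A set of probability measures is convex if it is convex in the cone of all measures. -/
def ConvexMeasureSet {Y : Type*} [MeasurableSpace Y] (Q : Set (ProbabilityMeasure Y)) : Prop :=
  Convex ℝ≥0 ((fun ν : ProbabilityMeasure Y => (ν : Measure Y)) '' Q)

/-- The probability measures on `∏ₙ Xₙ` whose `n`-th marginal lies in `P n` for every `n`. -/
def measuresWithMarginalsIn {ι : Type*} {X : ι → Type*} [∀ n, MeasurableSpace (X n)]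
    (P : ∀ n, Set (ProbabilityMeasure (X n))) : Set (ProbabilityMeasure (∀ n, X n)) :=
  {μ | ∀ n, μ.map (measurable_pi_apply n).aemeasurable ∈ P n}

/-- The statement `φ(f) = max_{μ ∈ M} (∫ f dμ - φ*_{C_b}(μ))`, including that the maximum is
attained. -/
def HasMaxRepresentationAt {Y : Type*} [TopologicalSpace Y] [MeasurableSpace Y]
    (φ : BoundedBorel Y → ℝ) (M : Set (ProbabilityMeasure Y)) (f : BoundedBorel Y) : Prop :=
  IsGreatest
    ((fun μ : ProbabilityMeasure Y =>
      ((∫ y, (f : Y → ℝ) y ∂(μ : Measure Y) : ℝ) : EReal)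
        - convexConjugate φ (boundedContinuous Y) μ.toFiniteMeasure) '' M)
    ((φ f : ℝ) : EReal)

end

open Filter Topology Set
open scoped CompactlySupported

/-! By Hahn–Banach, `φ` has a subgradient `L` at `f`. Testing the domination of `φ` at `f + t • h`
and letting `t → ∞` washes out `f` and `φ f`, so `L` inherits the bound `L h ≤ m + ∑ φₙ(gₙ)`
whenever `h ≤ m + ⊕ g`. Constants show that `L` is positive and normalized, functions of one
coordinate show that its marginals lie below `φₙ`, and `gₙ = 1` off a compact `Kₙ` shows that `L` is
tight.

Tightness makes `L` a probability measure `μ` on `C_b` (`exists_probabilityMeasure_integral_eq`),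
and `ConvexMeasureSet.mem_of_forall_integral_le` puts its marginals in `P n`. For upper
semicontinuous `f`, approximation from above gives `L f ≤ ∫ f dμ`, so the subgradient inequality
yields `φ*(μ) ≤ ∫ f dμ - φ f`. The reverse holds for every `μ` once `f` is a competitor in the
conjugate; the extra hypothesis supplies this on `U_b`. -/

/-! ### Subgradients of convex functions -/

/-- A convex function that is finite on the whole space has a subgradient at every point. -/
theorem ConvexOn.exists_subgradient {V : Type*} [AddCommGroup V] [Module ℝ V] {φ : V → ℝ}
    (hφ : ConvexOn ℝ univ φ) (f : V) : ∃ L : V →ₗ[ℝ] ℝ, ∀ h, L h ≤ φ (f + h) - φ f := by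
  -- The left point is the convex combination of `f + s • h` and `f + t • k` with weights `t / (s +
  -- t)` and `s / (s + t)`; this becomes subadditivity of `N`.
  have key (h k : V) {s t : ℝ} (hs : 0 < s) (ht : 0 < t) :
      (φ (f + (s * t / (s + t)) • (h + k)) - φ f) / (s * t / (s + t)) ≤
        (φ (f + s • h) - φ f) / s + (φ (f + t • k) - φ f) / t := by
    have h2 := hφ.2 (mem_univ (f + s • h)) (mem_univ (f + t • k))
      (show 0 ≤ t / (s + t) by positivity) (show 0 ≤ s / (s + t) by positivity)
      (by field_simp; ring)
    have e : (t / (s + t)) • (f + s • h) + (s / (s + t)) • (f + t • k) =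
        f + (s * t / (s + t)) • (h + k) := by
      have : f = (t / (s + t)) • f + (s / (s + t)) • f := by
        rw [← add_smul, ← add_div, add_comm t s, div_self (by positivity), one_smul]
      conv_rhs => rw [this]
      simp only [smul_add, smul_smul]
      rw [show t / (s + t) * s = s * t / (s + t) by ring,
        show s / (s + t) * t = s * t / (s + t) by ring]
      abel
    rw [e, smul_eq_mul, smul_eq_mul] at h2
    rw [div_le_iff₀ (by positivity)]
    have : ((φ (f + s • h) - φ f) / s + (φ (f + t • k) - φ f) / t) * (s * t / (s + t)) =
        t / (s + t) * φ (f + s • h) + s / (s + t) * φ (f + t • k) - φ f := by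
      field_simp; ring
    linarith
  have low (h : V) {t : ℝ} (ht : 0 < t) : φ f - φ (f - h) ≤ (φ (f + t • h) - φ f) / t := by
    have := key (-h) h one_pos ht
    simp only [neg_add_cancel, smul_zero, add_zero, sub_self, zero_div, one_smul, div_one,
      ← sub_eq_add_neg] at this
    linarith
  -- The directional derivative of `φ` at `f`, as an infimum of difference quotients: a sublinear
  -- majorant for `L`.
  let N : V → ℝ := fun h => ⨅ t : Ioi (0 : ℝ), (φ (f + (t : ℝ) • h) - φ f) / t
  have bdd (h : V) : BddBelow (range fun t : Ioi (0 : ℝ) => (φ (f + (t : ℝ) • h) - φ f) / t) :=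
    ⟨φ f - φ (f - h), by rintro _ ⟨t, rfl⟩; exact low h t.2⟩
  have hN (h : V) {t : ℝ} (ht : 0 < t) : N h ≤ (φ (f + t • h) - φ f) / t :=
    ciInf_le (bdd h) ⟨t, ht⟩
  have : Nonempty (Ioi (0 : ℝ)) := ⟨1, mem_Ioi.2 one_pos⟩
  have hle (c : ℝ) (hc : 0 < c) (x : V) : N (c • x) ≤ c * N x := by
    rw [Real.mul_iInf_of_nonneg hc.le]
    refine le_ciInf fun t => ?_
    have ht : (0 : ℝ) < t := t.2
    refine (hN (c • x) (div_pos ht hc)).trans (le_of_eq ?_)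
    rw [smul_smul, div_mul_cancel₀ _ hc.ne']
    field_simp
  obtain ⟨L, -, hL⟩ := exists_extension_of_le_sublinear ⟨⊥, 0⟩ N
    (fun c hc x => by
      refine le_antisymm (hle c hc x) ?_
      have := hle c⁻¹ (inv_pos.2 hc) (c • x)
      rw [smul_smul, inv_mul_cancel₀ hc.ne', one_smul] at this
      rwa [← le_inv_mul_iff₀ hc])
    (fun x y => by
      refine le_ciInf_add_ciInf fun s t => ?_
      have hs : (0 : ℝ) < s := s.2
      have ht : (0 : ℝ) < t := t.2
      exact (hN (x + y) (by positivity)).trans (key x y hs ht))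
    (by
      rintro ⟨x, hx⟩
      obtain rfl : x = 0 := by simpa using hx
      refine le_ciInf fun t => ?_
      simp)
  exact ⟨L, fun h => (hL h).trans (by simpa using hN h one_pos)⟩

/-! ### Compact sets of probability measures -/

/-- Compact sets of probability measures on a Polish space are uniformly tight. -/
theorem IsCompact.exists_isCompact_measure_compl_le {Y : Type*} [TopologicalSpace Y]
    [PolishSpace Y] [MeasurableSpace Y] [BorelSpace Y] {Q : Set (ProbabilityMeasure Y)}
    (hQ : IsCompact Q) {ε : ℝ≥0∞} (hε : 0 < ε) :
    ∃ K : Set Y, IsCompact K ∧ ∀ ν ∈ Q, (ν : Measure Y) Kᶜ ≤ ε := by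
  let _ := TopologicalSpace.upgradeIsCompletelyMetrizable Y
  have h := isTightMeasureSet_of_isCompact_closure (S := Q) (hQ.isClosed.closure_eq.symm ▸ hQ)
  rw [isTightMeasureSet_iff_exists_isCompact_measure_compl_le] at h
  obtain ⟨K, hK, h⟩ := h ε hε
  exact ⟨K, hK, fun ν hν => h ν ⟨ν, hν, rfl⟩⟩

/-- A compact convex set of probability measures is determined by its support function on bounded
continuous functions. -/
theorem ConvexMeasureSet.mem_of_forall_integral_le {Y : Type*} [TopologicalSpace Y]
    [MeasurableSpace Y] [BorelSpace Y] [HasOuterApproxClosed Y]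
    {Q : Set (ProbabilityMeasure Y)} (hconv : ConvexMeasureSet Q)
    (hcomp : IsCompact Q) {μ : ProbabilityMeasure Y}
    (h : ∀ (g : BoundedContinuousFunction Y ℝ) (c : ℝ),
      (∀ ν ∈ Q, ∫ y, g y ∂(ν : Measure Y) ≤ c) → ∫ y, g y ∂(μ : Measure Y) ≤ c) :
    μ ∈ Q := by
  classical
  by_contra hμ
  have hcont (g : BoundedContinuousFunction Y ℝ) :
      Continuous fun ν : ProbabilityMeasure Y => ∫ y, g y ∂(ν : Measure Y) :=
    continuous_iff_continuousAt.2 fun ν =>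
      (ProbabilityMeasure.tendsto_iff_forall_integral_tendsto.1 tendsto_id) g
  -- Bounded continuous functions separate measures, so by compactness finitely many of them
  -- separate `μ` from all of `Q`. This reduces the claim to Hahn–Banach in `s → ℝ`.
  obtain ⟨s, hs⟩ := hcomp.elim_finite_subcover
    (fun g : BoundedContinuousFunction Y ℝ =>
      {ν : ProbabilityMeasure Y | ∫ y, g y ∂(ν : Measure Y) ≠ ∫ y, g y ∂(μ : Measure Y)})
    (fun g => isOpen_ne_fun (hcont g) continuous_const) (by
      intro ν hν
      by_contra hne
      simp only [mem_iUnion, mem_ofPred_eq, not_exists, not_not] at hne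
      refine hμ ?_
      have : ν = μ := Subtype.ext (ext_of_forall_integral_eq_of_IsFiniteMeasure
        (μ := (ν : Measure Y)) (ν := (μ : Measure Y)) hne)
      exact this ▸ hν)
  let T : ProbabilityMeasure Y → (s → ℝ) := fun ν g =>
    ∫ y, (g : BoundedContinuousFunction Y ℝ) y ∂(ν : Measure Y)
  have hT : Continuous T := continuous_pi fun g => hcont g
  have hconvT : Convex ℝ (T '' Q) := by
    rintro _ ⟨ν₁, hν₁, rfl⟩ _ ⟨ν₂, hν₂, rfl⟩ a b ha hb hab
    lift a to ℝ≥0 using ha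
    lift b to ℝ≥0 using hb
    obtain ⟨ν, hν, hνe⟩ := hconv ⟨ν₁, hν₁, rfl⟩ ⟨ν₂, hν₂, rfl⟩ (zero_le (a := a)) (zero_le (a := b))
      (by exact_mod_cast hab)
    refine ⟨ν, hν, ?_⟩
    ext g
    have hi (ρ : ProbabilityMeasure Y) (c : ℝ≥0) : Integrable (g : Y → ℝ) (c • (ρ : Measure Y)) :=
      (BoundedContinuousFunction.integrable _ (g : BoundedContinuousFunction Y ℝ)).smul_measure_nnreal
    simp only at hνe
    simp only [T, hνe, Pi.add_apply, Pi.smul_apply]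
    rw [integral_add_measure (hi _ _) (hi _ _), integral_smul_nnreal_measure,
      integral_smul_nnreal_measure]
    rfl
  have hnot : T μ ∉ T '' Q := by
    rintro ⟨ν, hν, he⟩
    obtain ⟨g, hg, hne⟩ := mem_iUnion₂.1 (hs hν)
    exact hne (congrFun he ⟨g, hg⟩)
  obtain ⟨ℓ, u, hu, hu'⟩ :=
    geometric_hahn_banach_closed_point hconvT (hcomp.image hT).isClosed hnot
  have hℓ (ν : ProbabilityMeasure Y) :
      ℓ (T ν) = ∫ y, (∑ g : s, ℓ (Pi.single g 1) • (g : BoundedContinuousFunction Y ℝ)) y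
        ∂(ν : Measure Y) := by
    have := LinearMap.pi_apply_eq_sum_univ (ℓ : (s → ℝ) →ₗ[ℝ] ℝ) (T ν)
    simp only [BoundedContinuousFunction.coe_sum, BoundedContinuousFunction.coe_smul,
      Finset.sum_apply]
    have hi (g : s) : Integrable (fun y =>
        (ℓ (Pi.single g 1) • ⇑(g : BoundedContinuousFunction Y ℝ)) y) (ν : Measure Y) :=
      (BoundedContinuousFunction.integrable _ (g : BoundedContinuousFunction Y ℝ)).smul _
    simp only [Pi.smul_apply] at hi
    rw [integral_finsetSum _ fun g _ => hi g]
    simp only [integral_smul]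
    refine this.trans (Finset.sum_congr rfl fun g _ => ?_)
    simp only [T, smul_eq_mul, mul_comm, ContinuousLinearMap.coe_coe]
    congr 3
    ext j
    simp [Pi.single_apply, eq_comm]
  have := h (∑ g : s, ℓ (Pi.single g 1) • (g : BoundedContinuousFunction Y ℝ)) u
    fun ν hν => (hℓ ν) ▸ (hu _ ⟨ν, hν, rfl⟩).le
  rw [← hℓ] at this
  exact this.not_gt hu'

/-! ### Approximation of semicontinuous functions -/

/-- A bounded upper semicontinuous function on a metrizable space is the pointwise limit of a
uniformly bounded sequence of continuous functions lying above it. -/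
theorem UpperSemicontinuous.exists_seq_continuous_tendsto {Y : Type*} [TopologicalSpace Y]
    [TopologicalSpace.MetrizableSpace Y] {f : Y → ℝ} (hf : UpperSemicontinuous f) {C : ℝ}
    (hC : ∀ y, |f y| ≤ C) :
    ∃ F : ℕ → Y → ℝ, (∀ n, Continuous (F n)) ∧ (∀ n y, |F n y| ≤ C) ∧ (∀ n y, f y ≤ F n y) ∧
      ∀ y, Tendsto (fun n => F n y) atTop (𝓝 (f y)) := by
  let _ := TopologicalSpace.metrizableSpaceMetric Y
  rcases isEmpty_or_nonempty Y with hY | hY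
  · exact ⟨fun _ => f, fun _ => continuous_of_discreteTopology, fun _ y => hC y,
      fun _ _ => le_rfl, fun _ => tendsto_const_nhds⟩
  have hb (n : ℕ) (x z : Y) : f z - n * dist x z ≤ C :=
    (sub_le_self _ (by positivity)).trans ((le_abs_self _).trans (hC z))
  have bdd (n : ℕ) (x : Y) : BddAbove (range fun z => f z - n * dist x z) :=
    ⟨C, by rintro _ ⟨z, rfl⟩; exact hb n x z⟩
  -- Sup-convolution: `F n` is `n`-Lipschitz, and for large `n` the penalty rules out points `z` far
  -- from `x`.
  let F : ℕ → Y → ℝ := fun n x => ⨆ z, (f z - n * dist x z)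
  have hge (n : ℕ) (x : Y) : f x ≤ F n x := by simpa using le_ciSup (bdd n x) x
  have hle (n : ℕ) (x : Y) : F n x ≤ C := ciSup_le (hb n x)
  refine ⟨F, fun n => ?_, fun n x => abs_le.2 ⟨(abs_le.1 (hC x)).1.trans (hge n x), hle n x⟩, hge,
    fun x => ?_⟩
  · refine (LipschitzWith.of_le_add_mul (n : ℝ≥0) fun x y => ciSup_le fun z => ?_).continuous
    have h1 : f z - n * dist y z ≤ F n y := le_ciSup (bdd n y) z
    have h2 := mul_le_mul_of_nonneg_left (dist_triangle y x z) (Nat.cast_nonneg (α := ℝ) n)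
    rw [dist_comm y x] at h2
    simp only [NNReal.coe_natCast]
    linarith
  · refine tendsto_order.2 ⟨fun a ha => Eventually.of_forall fun n => ha.trans_le (hge n x),
      fun a ha => ?_⟩
    obtain ⟨b, hb1, hb2⟩ := exists_between ha
    obtain ⟨δ, hδ, hball⟩ := Metric.eventually_nhds_iff.1 (hf x b hb1)
    obtain ⟨n₀, hn₀⟩ := exists_nat_ge ((C - b) / δ)
    filter_upwards [eventually_ge_atTop n₀] with n hn
    refine lt_of_le_of_lt (ciSup_le fun z => ?_) hb2
    rcases lt_or_ge (dist x z) δ with hz | hz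
    · have := hball (y := z) (by rwa [dist_comm])
      have : 0 ≤ n * dist x z := by positivity
      linarith
    · have h1 : (C - b) ≤ n₀ * δ := (div_le_iff₀ hδ).1 hn₀
      have h2 : (n₀ : ℝ) * δ ≤ n * dist x z := by gcongr
      have := (le_abs_self _).trans (hC z)
      linarith

/-! ### Riesz representation through the Stone–Čech compactification -/

/-- The constant function `c` as a bounded Borel function. -/
def BoundedBorel.const (Y : Type*) [MeasurableSpace Y] (c : ℝ) : BoundedBorel Y :=
  ⟨fun _ => c, measurable_const, |c|, fun _ => le_rfl⟩

theorem BoundedBorel.integrable {Y : Type*} [MeasurableSpace Y] (h : BoundedBorel Y)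
    (μ : Measure Y) [IsFiniteMeasure μ] : Integrable (h : Y → ℝ) μ := by
  obtain ⟨C, hC⟩ := h.2.2
  exact Integrable.of_bound h.2.1.aestronglyMeasurable C (Eventually.of_forall hC)

/-- A positive normalized linear functional on the bounded Borel functions that is concentrated on
compact sets up to `ε` is given, on bounded continuous functions, by a probability measure. -/
theorem exists_probabilityMeasure_integral_eq {E : Type*} [TopologicalSpace E] [T35Space E]
    [MeasurableSpace E] [BorelSpace E] (L : BoundedBorel E →ₗ[ℝ] ℝ)
    (hpos : ∀ h : BoundedBorel E, (∀ x, (h : E → ℝ) x ≤ 0) → L h ≤ 0)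
    (hone : L (BoundedBorel.const E 1) = 1)
    (htight : ∀ ε : ℝ, 0 < ε → ∃ K : Set E, IsCompact K ∧ ∀ h : BoundedBorel E,
      (∀ x, (h : E → ℝ) x ≤ 1) → (∀ x ∈ K, (h : E → ℝ) x ≤ 0) → L h ≤ ε) :
    ∃ μ : ProbabilityMeasure E, ∀ h ∈ boundedContinuous E,
      ∫ x, (h : E → ℝ) x ∂(μ : Measure E) = L h := by
  let _ : MeasurableSpace (StoneCech E) := borel _
  have : BorelSpace (StoneCech E) := ⟨rfl⟩
  let i : E → StoneCech E := stoneCechUnit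
  have hi : IsEmbedding i := isEmbedding_stoneCechUnit
  let pull : C_c(StoneCech E, ℝ) → BoundedBorel E := fun h =>
    ⟨fun x => h (i x), (h.continuous.comp hi.continuous).measurable,
      ‖h.toBoundedContinuousFunction‖, fun x =>
        h.toBoundedContinuousFunction.norm_coe_le_norm (i x)⟩
  let Λ : C_c(StoneCech E, ℝ) →ₚ[ℝ] ℝ :=
    { toFun := fun h => L (pull h)
      map_add' := fun g h => by rw [← map_add]; rfl
      map_smul' := fun c h => by rw [RingHom.id_apply, ← map_smul]; rfl
      monotone' := fun g h hgh => by
        have := hpos (pull g - pull h) fun x => sub_nonpos.2 (hgh (i x))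
        rw [map_sub] at this
        exact sub_nonpos.1 this }
  let ρ := RealRMK.rieszMeasure Λ
  have hρint (h : C_c(StoneCech E, ℝ)) : ∫ y, h y ∂ρ = L (pull h) :=
    RealRMK.integral_rieszMeasure Λ h
  have hρ1 : ρ univ = 1 := by
    let o : C_c(StoneCech E, ℝ) := ⟨1, HasCompactSupport.of_compactSpace 1⟩
    have h1 : ∫ y, o y ∂ρ = 1 := (hρint o).trans hone
    have h2 : ∫ y, o y ∂ρ = ρ.real univ := by
      change ∫ _, (1 : ℝ) ∂ρ = _
      simp
    rw [h2, measureReal_def, ENNReal.toReal_eq_one_iff] at h1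
    exact h1
  have hρp : IsProbabilityMeasure ρ := ⟨hρ1⟩
  have hρreg : ρ.Regular := RealRMK.regular_rieszMeasure Λ
  choose K hK hKL using fun n : ℕ => htight (1 / (n + 1)) (by positivity)
  have hiK (n : ℕ) : IsCompact (i '' K n) := (hK n).image hi.continuous
  -- Outer regularity reduces this to open `U ⊇ i '' K n`. For a Urysohn function `u` equal to `1`
  -- on `i '' K n` and supported in `U`, tightness applied to `1 - u` gives `L u ≥ 1 - 1 / (n + 1)`.
  have hρK (n : ℕ) : ENNReal.ofReal (1 - 1 / (n + 1)) ≤ ρ (i '' K n) := by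
    rw [(hiK n).measure_eq_iInf_isOpen]
    refine le_iInf₂ fun U hKU => le_iInf fun hU => ?_
    obtain ⟨V, hV, hKV, hVU⟩ := normal_exists_closure_subset (hiK n).isClosed hU hKU
    obtain ⟨u, hu1, hu0, hu⟩ := exists_continuous_zero_one_of_isClosed hV.isClosed_compl
      (hiK n).isClosed (disjoint_compl_left_iff_subset.2 hKV)
    let u' : C_c(StoneCech E, ℝ) := ⟨u, HasCompactSupport.of_compactSpace _⟩
    have huV : Function.support u' ⊆ V := fun y hy => by_contra fun hyV => hy (hu1 hyV)
    have hsupp : tsupport u' ⊆ U := (closure_mono huV).trans hVU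
    refine le_trans ?_ (RealRMK.le_rieszMeasure_tsupport_subset Λ (f := u') hu hsupp)
    refine ENNReal.ofReal_le_ofReal ?_
    have := hKL n (BoundedBorel.const E 1 - pull u') (fun x => sub_le_self _ (hu (i x)).1)
      (fun x hx => sub_nonpos.2 (hu0 ⟨x, hx, rfl⟩).ge)
    rw [map_sub, hone] at this
    change _ ≤ L (pull u')
    linarith
  let S := ⋃ n, i '' K n
  have hSm : MeasurableSet S := .iUnion fun n => (hiK n).isClosed.measurableSet
  have hSi : S ⊆ range i := iUnion_subset fun n => image_subset_range _ _
  have hS : ρ Sᶜ = 0 := by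
    rw [prob_compl_eq_zero_iff hSm]
    refine le_antisymm prob_le_one ?_
    have ht : Tendsto (fun n : ℕ => ENNReal.ofReal (1 - 1 / ((n : ℝ) + 1))) atTop (𝓝 1) := by
      have := ENNReal.tendsto_ofReal
        (tendsto_one_div_add_atTop_nhds_zero_nat (𝕜 := ℝ).const_sub 1)
      simpa using this
    exact le_of_tendsto' ht fun n => (hρK n).trans (measure_mono (subset_iUnion (fun n => i '' K n) n))
  have hrange : ρ (range i)ᶜ = 0 := measure_mono_null (compl_subset_compl.2 hSi) hS
  -- `range i` need not be Borel, but it contains the conull σ-compact set `S`, so images of Borel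
  -- sets are null-measurable.
  have hnull (s : Set E) (hs : MeasurableSet s) : NullMeasurableSet (i '' s) ρ := by
    rw [BorelSpace.measurable_eq (α := E), hi.eq_induced, borel_comap] at hs
    obtain ⟨t, ht, rfl⟩ := hs
    rw [image_preimage_eq_inter_range]
    exact (show MeasurableSet t from ht).nullMeasurableSet.inter
      (NullMeasurableSet.of_null hrange).of_compl
  have hmap : (ρ.comap i).map i = ρ := by
    ext s hs
    have his := hi.continuous.measurable hs
    rw [Measure.map_apply hi.continuous.measurable hs,
      Measure.comap_apply₀ i ρ hi.injective hnull his.nullMeasurableSet,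
      image_preimage_eq_inter_range]
    exact measure_inter_conull hrange
  have hp : IsProbabilityMeasure (ρ.comap i) := by
    refine ⟨?_⟩
    rw [← hρ1, ← hmap, Measure.map_apply hi.continuous.measurable .univ, preimage_univ]
    rw [hmap]
  refine ⟨⟨ρ.comap i, hp⟩, fun h hh => ?_⟩
  obtain ⟨C, hC⟩ := h.2.2
  let g : E → Icc (-C) C := fun x => ⟨(h : E → ℝ) x, abs_le.1 (hC x)⟩
  have hg : Continuous g := Continuous.subtype_mk hh _
  let G : C_c(StoneCech E, ℝ) :=
    ⟨⟨fun y => (stoneCechExtend hg y : Icc (-C) C), continuous_subtype_val.comp (continuous_stoneCechExtend hg)⟩,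
      HasCompactSupport.of_compactSpace _⟩
  have hG (x : E) : G (i x) = (h : E → ℝ) x :=
    congrArg Subtype.val (stoneCechExtend_stoneCechUnit hg x)
  have hpull : pull G = h := Subtype.ext (funext hG)
  rw [← hpull, ← hρint]
  conv_rhs => rw [← hmap]
  exact (integral_map hi.continuous.measurable.aemeasurable (f := (G : StoneCech E → ℝ))
    G.continuous.measurable.aestronglyMeasurable).symm

/-! ### Upper expectations -/

section UpperExpectation

variable {Y : Type*} [MeasurableSpace Y] {Q : Set (ProbabilityMeasure Y)}

theorem upperExpectation_le (hQ : Q.Nonempty) {g : BoundedBorel Y} {c : ℝ}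
    (h : ∀ ν ∈ Q, ∫ y, (g : Y → ℝ) y ∂(ν : Measure Y) ≤ c) : upperExpectation Q g ≤ c :=
  csSup_le (hQ.image _) (by rintro _ ⟨ν, hν, rfl⟩; exact h ν hν)

theorem upperExpectation_smul (Q : Set (ProbabilityMeasure Y)) (g : BoundedBorel Y) {t : ℝ}
    (ht : 0 ≤ t) : upperExpectation Q (t • g) = t * upperExpectation Q g := by
  rw [upperExpectation, upperExpectation, ← smul_eq_mul, ← Real.sSup_smul_of_nonneg ht,
    ← image_smul, image_image]
  congr 1
  refine image_congr fun ν _ => ?_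
  exact integral_const_mul t _

end UpperExpectation

theorem EReal.coe_add_mul_le_of_le_coe_add {u h m C t : ℝ} {a : ℝ≥0∞} (ht : 0 < t) (hu : u ≤ C)
    (hh : (h : EReal) ≤ (m : EReal) + (a : EReal)) :
    ((u + t * h : ℝ) : EReal) ≤
      ((C + t * m : ℝ) : EReal) + ((ENNReal.ofReal t * a : ℝ≥0∞) : EReal) := by
  rcases eq_or_ne a ⊤ with rfl | ha
  · rw [ENNReal.mul_top (by simpa using ht), EReal.coe_ennreal_top, EReal.coe_add_top]
    exact le_top
  · lift a to ℝ≥0 using ha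
    have e : ENNReal.ofReal t * (a : ℝ≥0∞) = ((t.toNNReal * a : ℝ≥0) : ℝ≥0∞) := by
      rw [ENNReal.coe_mul]; rfl
    rw [e]
    change (h : EReal) ≤ (m : EReal) + ((a : ℝ) : EReal) at hh
    change _ ≤ _ + (((t.toNNReal * a : ℝ≥0) : ℝ) : EReal)
    rw [← EReal.coe_add, EReal.coe_le_coe_iff] at hh ⊢
    push_cast
    rw [Real.coe_toNNReal t ht.le]
    nlinarith

/-! ### Domination passes to subgradients -/

section Domination

variable {ι : Type*} {X : ι → Type*} [∀ n, MeasurableSpace (X n)]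

/-- The domination of `φ` by the super-hedging functional `f ↦ inf {m + ∑ₙ φₙ(gₙ) | f ≤ m + ⊕ g}`. -/
def DominatedBy (φ : BoundedBorel (∀ n, X n) → ℝ) (P : ∀ n, Set (ProbabilityMeasure (X n))) :
    Prop :=
  ∀ (f : BoundedBorel (∀ n, X n)) (m : ℝ) (g : ∀ n, BoundedBorel (X n)),
    (∀ n, 0 ≤ g n) →
    (∀ x, (((f : (∀ n, X n) → ℝ) x : ℝ) : EReal) ≤ (m : EReal) + (directSumFn g x : EReal)) →
    ((φ f : ℝ) : EReal) ≤
      (m : EReal) + ((∑' n, ENNReal.ofReal (upperExpectation (P n) (g n)) : ℝ≥0∞) : EReal)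

variable {P : ∀ n, Set (ProbabilityMeasure (X n))} {φ : BoundedBorel (∀ n, X n) → ℝ}
  {f : BoundedBorel (∀ n, X n)} {L : BoundedBorel (∀ n, X n) →ₗ[ℝ] ℝ}

/-- A subgradient of a dominated functional is dominated as well. -/
theorem DominatedBy.subgradient_le (hφ : DominatedBy φ P) (hL : ∀ h, L h ≤ φ (f + h) - φ f)
    {h : BoundedBorel (∀ n, X n)} {m s : ℝ} {g : ∀ n, BoundedBorel (X n)} (hg : ∀ n, 0 ≤ g n)
    (hh : ∀ x, (((h : (∀ n, X n) → ℝ) x : ℝ) : EReal) ≤ (m : EReal) + (directSumFn g x : EReal))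
    (hs : 0 ≤ s) (hgs : ∑' n, ENNReal.ofReal (upperExpectation (P n) (g n)) ≤ ENNReal.ofReal s) :
    L h ≤ m + s := by
  obtain ⟨C, hC⟩ := f.2.2
  have key {t : ℝ} (ht : 0 < t) : t * L h ≤ C - φ f + t * (m + s) := by
    have h1 := hL (t • h)
    rw [map_smul, smul_eq_mul] at h1
    have h2 := hφ (f + t • h) (C + t * m) (fun n => t • g n)
      (fun n x => mul_nonneg ht.le (hg n x)) fun x => by
        have e : directSumFn (fun n => t • g n) x = ENNReal.ofReal t * directSumFn g x := by
          rw [directSumFn, directSumFn, ← ENNReal.tsum_mul_left]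
          exact tsum_congr fun n => ENNReal.ofReal_mul ht.le
        rw [e]
        exact EReal.coe_add_mul_le_of_le_coe_add ht ((le_abs_self _).trans (hC x)) (hh x)
    have h3 : ∑' n, ENNReal.ofReal (upperExpectation (P n) (t • g n)) ≤ ENNReal.ofReal (t * s) := by
      rw [ENNReal.ofReal_mul ht.le]
      simp_rw [upperExpectation_smul _ _ ht.le, ENNReal.ofReal_mul ht.le, ENNReal.tsum_mul_left]
      gcongr
    have h4 := h2.trans (add_le_add_right (EReal.coe_ennreal_le_coe_ennreal_iff.2 h3) _)
    rw [EReal.coe_ennreal_ofReal, max_eq_left (by positivity), ← EReal.coe_add,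
      EReal.coe_le_coe_iff] at h4
    linarith
  by_contra! hlt
  set d := L h - (m + s) with hd
  have hd0 : 0 < d := sub_pos.2 hlt
  -- This `t` makes `t * d` exceed `C - φ f`, contradicting `key`.
  have h1 := key (t := (|C - φ f| + 1) / d) (by positivity)
  have h2 : (|C - φ f| + 1) / d * d = |C - φ f| + 1 := div_mul_cancel₀ _ hd0.ne'
  have h3 := le_abs_self (C - φ f)
  nlinarith

theorem upperExpectation_zero_le {Y : Type*} [MeasurableSpace Y] {Q : Set (ProbabilityMeasure Y)}
    (hQ : Q.Nonempty) : upperExpectation Q 0 ≤ 0 :=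
  upperExpectation_le hQ fun ν _ => by simp

/-- The case `g = 0`: it yields positivity with `m = 0`, and normalization from the constants `1`
and `-1`. -/
theorem DominatedBy.subgradient_le_of_forall_le (hφ : DominatedBy φ P)
    (hP : ∀ n, (P n).Nonempty) (hL : ∀ h, L h ≤ φ (f + h) - φ f) {h : BoundedBorel (∀ n, X n)}
    {m : ℝ} (hh : ∀ x, (h : (∀ n, X n) → ℝ) x ≤ m) : L h ≤ m := by
  simpa using hφ.subgradient_le hL (g := fun _ => 0) (s := 0) (m := m) (fun _ => le_rfl)
    (fun x => by
      simpa [directSumFn] using hh x) le_rfl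
    (by simp [ENNReal.ofReal_of_nonpos (upperExpectation_zero_le (hP _))])

/-- A subgradient is dominated by the upper expectation on functions of a single coordinate. -/
theorem DominatedBy.subgradient_comp_eval_le (hφ : DominatedBy φ P)
    (hP : ∀ n, (P n).Nonempty) (hL : ∀ h, L h ≤ φ (f + h) - φ f) (n : ι) (g : BoundedBorel (X n))
    {c : ℝ} (hc : ∀ ν ∈ P n, ∫ y, (g : X n → ℝ) y ∂(ν : Measure (X n)) ≤ c)
    {h : BoundedBorel (∀ n, X n)} (hh : ∀ x, (h : (∀ n, X n) → ℝ) x = (g : X n → ℝ) (x n)) :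
    L h ≤ c := by
  classical
  obtain ⟨C, hC⟩ := g.2.2
  have hint (ν : ProbabilityMeasure (X n)) : ∫ y, ((g + BoundedBorel.const (X n) C :
      BoundedBorel (X n)) : X n → ℝ) y ∂(ν : Measure (X n)) =
      ∫ y, (g : X n → ℝ) y ∂(ν : Measure (X n)) + C := by
    change ∫ y, ((g : X n → ℝ) y + C) ∂(ν : Measure (X n)) = _
    rw [integral_add (BoundedBorel.integrable g _) (integrable_const C)]
    simp
  have hnn (y : X n) : 0 ≤ (g : X n → ℝ) y + C := by linarith [(abs_le.1 (hC y)).1]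
  obtain ⟨ν₀, hν₀⟩ := hP n
  have hcC : 0 ≤ c + C := by
    have h1 := hc ν₀ hν₀
    have h2 : 0 ≤ ∫ y, ((g + BoundedBorel.const (X n) C : BoundedBorel (X n)) : X n → ℝ) y
      ∂(ν₀ : Measure (X n)) := integral_nonneg hnn
    rw [hint] at h2
    linarith
  -- Adding `C` makes `g` nonnegative, as domination requires; `m = -C` undoes the shift.
  have := hφ.subgradient_le hL (h := h) (g := Pi.single n (g + BoundedBorel.const (X n) C))
    (m := -C) (s := c + C)
    (fun k => by
      obtain rfl | hk := eq_or_ne k n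
      · rw [Pi.single_eq_same]; exact hnn
      · rw [Pi.single_eq_of_ne hk])
    (fun x => by
      have h1 : ENNReal.ofReal ((g : X n → ℝ) (x n) + C) ≤
          directSumFn (Pi.single n (g + BoundedBorel.const (X n) C)) x := by
        refine le_trans (le_of_eq ?_) (ENNReal.le_tsum n)
        rw [Pi.single_eq_same]
        rfl
      refine le_trans ?_ (add_le_add_right (EReal.coe_ennreal_le_coe_ennreal_iff.2 h1) _)
      rw [EReal.coe_ennreal_ofReal, max_eq_left (hnn _), ← EReal.coe_add, EReal.coe_le_coe_iff,
        hh x]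
      linarith)
    hcC
    (by
      rw [tsum_eq_single n fun k hk => by
        rw [Pi.single_eq_of_ne hk]
        exact ENNReal.ofReal_of_nonpos (upperExpectation_zero_le (hP k))]
      rw [Pi.single_eq_same]
      exact ENNReal.ofReal_le_ofReal (upperExpectation_le (hP n) fun ν hν => by
        rw [hint]; linarith [hc ν hν]))
  linarith

/-- A subgradient is concentrated on compact sets up to `ε`. -/
theorem DominatedBy.subgradient_tight [Countable ι] [∀ n, TopologicalSpace (X n)]
    [∀ n, PolishSpace (X n)] [∀ n, BorelSpace (X n)] (hφ : DominatedBy φ P)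
    (hP : ∀ n, (P n).Nonempty) (hPc : ∀ n, IsCompact (P n))
    (hL : ∀ h, L h ≤ φ (f + h) - φ f) {ε : ℝ} (hε : 0 < ε) :
    ∃ K : Set (∀ n, X n), IsCompact K ∧ ∀ h : BoundedBorel (∀ n, X n),
      (∀ x, (h : (∀ n, X n) → ℝ) x ≤ 1) → (∀ x ∈ K, (h : (∀ n, X n) → ℝ) x ≤ 0) → L h ≤ ε := by
  obtain ⟨δ, hδ, hδε⟩ := ENNReal.exists_pos_sum_of_countable' (ENNReal.ofReal_pos.2 hε).ne' ι
  choose K hK hKP using fun n => (hPc n).exists_isCompact_measure_compl_le (hδ n)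
  have hKm (n : ι) : MeasurableSet (K n)ᶜ := (hK n).measurableSet.compl
  refine ⟨univ.pi K, isCompact_univ_pi hK, fun h h1 h0 => ?_⟩
  let g : ∀ n, BoundedBorel (X n) := fun n =>
    ⟨(K n)ᶜ.indicator 1, measurable_one.indicator (hKm n), 1, fun y => by
      by_cases hy : y ∈ (K n)ᶜ <;> simp [hy]⟩
  have := hφ.subgradient_le hL (h := h) (g := g) (m := 0) (s := ε)
    (fun n y => indicator_nonneg (fun _ _ => zero_le_one) y)
    (fun x => by
      rw [EReal.coe_zero, zero_add]
      by_cases hx : x ∈ univ.pi K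
      · exact (EReal.coe_le_coe_iff.2 (h0 x hx)).trans (EReal.coe_ennreal_nonneg _)
      · simp only [mem_univ_pi, not_forall] at hx
        obtain ⟨n, hn⟩ := hx
        -- Outside the product some coordinate leaves its `K n`, and that one term is already `1`.
        have h2 : 1 ≤ directSumFn g x := by
          refine le_trans (le_of_eq ?_) (ENNReal.le_tsum n)
          simp [g, hn]
        refine (EReal.coe_le_coe_iff.2 (h1 x)).trans ?_
        simpa using EReal.coe_ennreal_le_coe_ennreal_iff.2 h2)
    hε.le
    (by
      refine le_trans (ENNReal.tsum_le_tsum fun n => ?_) hδε.le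
      have hfin : δ n ≠ ⊤ := ((ENNReal.le_tsum n).trans_lt (hδε.trans ENNReal.ofReal_lt_top)).ne
      refine ENNReal.ofReal_le_of_le_toReal (upperExpectation_le (hP n) fun ν hν => ?_)
      change ∫ y, (K n)ᶜ.indicator 1 y ∂(ν : Measure (X n)) ≤ _
      rw [integral_indicator_one (hKm n)]
      exact ENNReal.toReal_mono hfin (hKP n ν hν))
  simpa using this

end Domination

/-! ### Duality -/

/-- A positive functional represented by `μ` on bounded continuous functions is dominated by `μ` on
bounded upper semicontinuous functions. -/
theorem le_integral_of_mem_boundedUSC {E : Type*} [TopologicalSpace E]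
    [TopologicalSpace.MetrizableSpace E] [MeasurableSpace E] [BorelSpace E]
    {L : BoundedBorel E →ₗ[ℝ] ℝ} (hpos : ∀ h : BoundedBorel E, (∀ x, (h : E → ℝ) x ≤ 0) → L h ≤ 0)
    {μ : Measure E} [IsFiniteMeasure μ]
    (hμ : ∀ h ∈ boundedContinuous E, ∫ x, (h : E → ℝ) x ∂μ = L h)
    {f : BoundedBorel E} (hf : f ∈ boundedUSC E) : L f ≤ ∫ x, (f : E → ℝ) x ∂μ := by
  obtain ⟨C, hC⟩ := f.2.2
  obtain ⟨F, hFc, hFC, hfF, hF⟩ :=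
    UpperSemicontinuous.exists_seq_continuous_tendsto (f := (f : E → ℝ)) hf hC
  have hlim : Tendsto (fun n => ∫ x, F n x ∂μ) atTop (𝓝 (∫ x, (f : E → ℝ) x ∂μ)) :=
    tendsto_integral_of_dominated_convergence (fun _ => C)
      (fun n => (hFc n).measurable.aestronglyMeasurable) (integrable_const C)
      (fun n => Eventually.of_forall (hFC n)) (Eventually.of_forall hF)
  refine ge_of_tendsto' hlim fun n => ?_
  let G : BoundedBorel E := ⟨F n, (hFc n).measurable, C, hFC n⟩
  have h1 := hpos (f - G) fun x => sub_nonpos.2 (hfF n x)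
  rw [map_sub, ← hμ G (hFc n)] at h1
  exact sub_nonpos.1 h1

section Main

variable {ι : Type*} [Countable ι] {X : ι → Type*}
    [∀ n, TopologicalSpace (X n)] [∀ n, PolishSpace (X n)]
    [∀ n, MeasurableSpace (X n)] [∀ n, BorelSpace (X n)]
    {P : ∀ n, Set (ProbabilityMeasure (X n))} {φ : BoundedBorel (∀ n, X n) → ℝ}

/-- Every bounded upper semicontinuous `f` admits a measure with marginals in `P` at which the dual
value is at least `φ f`. -/
theorem DominatedBy.exists_convexConjugate_le (hφ : DominatedBy φ P)
    (hφ_convex : ConvexOn ℝ univ φ) (hP : ∀ n, (P n).Nonempty)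
    (hP_convex : ∀ n, ConvexMeasureSet (P n)) (hP_compact : ∀ n, IsCompact (P n))
    {f : BoundedBorel (∀ n, X n)} (hf : f ∈ boundedUSC (∀ n, X n)) :
    ∃ μ ∈ measuresWithMarginalsIn P,
      convexConjugate φ (boundedContinuous (∀ n, X n)) μ.toFiniteMeasure ≤
        ((∫ x, (f : (∀ n, X n) → ℝ) x ∂(μ : Measure (∀ n, X n)) - φ f : ℝ) : EReal) := by
  obtain ⟨L, hL⟩ := hφ_convex.exists_subgradient f
  have hpos (h : BoundedBorel (∀ n, X n)) (hh : ∀ x, (h : (∀ n, X n) → ℝ) x ≤ 0) : L h ≤ 0 :=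
    hφ.subgradient_le_of_forall_le hP hL hh
  have hone : L (BoundedBorel.const (∀ n, X n) 1) = 1 := by
    refine le_antisymm (hφ.subgradient_le_of_forall_le hP hL fun _ => le_rfl) ?_
    have := hφ.subgradient_le_of_forall_le hP hL (h := -BoundedBorel.const (∀ n, X n) 1) (m := -1)
      fun _ => le_rfl
    rw [map_neg] at this
    linarith
  obtain ⟨μ, hμ⟩ := exists_probabilityMeasure_integral_eq L hpos hone
    fun ε hε => hφ.subgradient_tight hP hP_compact hL hε
  refine ⟨μ, fun n => (hP_convex n).mem_of_forall_integral_le (hP_compact n) fun g c hc => ?_,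
    iSup₂_le fun h hh => EReal.coe_le_coe_iff.2 ?_⟩
  · let g' : BoundedBorel (X n) := ⟨g, g.continuous.measurable, ‖g‖, g.norm_coe_le_norm⟩
    let h : BoundedBorel (∀ n, X n) := ⟨fun x => g (x n),
      (g.continuous.comp (continuous_apply n)).measurable, ‖g‖, fun x => g.norm_coe_le_norm _⟩
    have h1 : L h ≤ c := hφ.subgradient_comp_eval_le hP hL n g' hc fun _ => rfl
    rw [← hμ h (g.continuous.comp (continuous_apply n))] at h1
    rw [ProbabilityMeasure.toMeasure_map, integral_map (measurable_pi_apply n).aemeasurable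
      g.continuous.measurable.aestronglyMeasurable]
    exact h1
  -- In direction `h - f` the subgradient inequality reads `L h - φ h ≤ L f - φ f`; then `L h = ∫ h
  -- dμ` and `L f ≤ ∫ f dμ`.
  · have h1 := hL (h - f)
    rw [add_sub_cancel, map_sub] at h1
    have h2 := le_integral_of_mem_boundedUSC hpos hμ hf
    have h3 := hμ h hh
    change ∫ x, (h : (∀ n, X n) → ℝ) x ∂(μ : Measure (∀ n, X n)) - φ h ≤ _
    linarith

/-- The dual representation holds at a bounded upper semicontinuous `f` that satisfies the
Fenchel–Young inequality with respect to the conjugate relative to the continuous functions. -/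
theorem DominatedBy.hasMaxRepresentationAt (hφ : DominatedBy φ P)
    (hφ_convex : ConvexOn ℝ univ φ) (hP : ∀ n, (P n).Nonempty)
    (hP_convex : ∀ n, ConvexMeasureSet (P n)) (hP_compact : ∀ n, IsCompact (P n))
    {f : BoundedBorel (∀ n, X n)} (hf : f ∈ boundedUSC (∀ n, X n))
    (hle : ∀ μ ∈ measuresWithMarginalsIn P,
      ((∫ x, (f : (∀ n, X n) → ℝ) x ∂(μ : Measure (∀ n, X n)) - φ f : ℝ) : EReal) ≤
        convexConjugate φ (boundedContinuous (∀ n, X n)) μ.toFiniteMeasure) :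
    HasMaxRepresentationAt φ (measuresWithMarginalsIn P) f := by
  constructor
  · obtain ⟨μ, hμ, h⟩ := hφ.exists_convexConjugate_le hφ_convex hP hP_convex hP_compact hf
    refine ⟨μ, hμ, ?_⟩
    simp only
    rw [le_antisymm h (hle μ hμ), ← EReal.coe_sub, sub_sub_cancel]
  · rintro _ ⟨μ, hμ, rfl⟩
    refine (EReal.sub_le_sub le_rfl (hle μ hμ)).trans ?_
    rw [← EReal.coe_sub, sub_sub_cancel]

end Main

theorem mainTheorem7 {ι : Type*} [Countable ι] {X : ι → Type*}
    [∀ n, TopologicalSpace (X n)] [∀ n, PolishSpace (X n)]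
    [∀ n, MeasurableSpace (X n)] [∀ n, BorelSpace (X n)]
    (P : ∀ n, Set (ProbabilityMeasure (X n)))
    (hP_nonempty : ∀ n, (P n).Nonempty)
    (hP_convex : ∀ n, ConvexMeasureSet (P n))
    (hP_compact : ∀ n, IsCompact (P n))
    (φ : BoundedBorel (∀ n, X n) → ℝ)
    (hφ_mono : Monotone φ)
    (hφ_convex : ConvexOn ℝ Set.univ φ)
    (hφ_dom : ∀ (f : BoundedBorel (∀ n, X n)) (m : ℝ) (g : ∀ n, BoundedBorel (X n)),
      (∀ n, 0 ≤ g n) →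
      (∀ x, (((f : (∀ n, X n) → ℝ) x : ℝ) : EReal) ≤ (m : EReal) + (directSumFn g x : EReal)) →
      ((φ f : ℝ) : EReal) ≤
        (m : EReal) + ((∑' n, ENNReal.ofReal (upperExpectation (P n) (g n)) : ℝ≥0∞) : EReal)) :
    (∀ f ∈ boundedContinuous (∀ n, X n),
      HasMaxRepresentationAt φ (measuresWithMarginalsIn P) f) ∧
    ((∀ μ ∈ measuresWithMarginalsIn P,
        convexConjugate φ (boundedContinuous (∀ n, X n)) μ.toFiniteMeasure =
          convexConjugate φ (boundedUSC (∀ n, X n)) μ.toFiniteMeasure) →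
      ∀ f ∈ boundedUSC (∀ n, X n),
        HasMaxRepresentationAt φ (measuresWithMarginalsIn P) f) := by
  have hdom : DominatedBy φ P := hφ_dom
  refine ⟨fun f hf => ?_, fun heq f hf => ?_⟩
  · exact hdom.hasMaxRepresentationAt hφ_convex hP_nonempty hP_convex hP_compact
      (Continuous.upperSemicontinuous hf) fun μ _ => le_iSup₂_of_le f hf le_rfl
  · exact hdom.hasMaxRepresentationAt hφ_convex hP_nonempty hP_convex hP_compact hf
      fun μ hμ => heq μ hμ ▸ le_iSup₂_of_le f hf le_rfl
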